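/- Let $X$ be a connected paracompact Hausdorff space, let $(Z_s)_{s\in S}$ be an arbitrary family of metrizable spaces each of which is equiconnected, i.e. there is a continuous map $\lambda_s: Z_s\times Z_s\times[0,1]\to Z_s$ with $\lambda_s(x,y,0)=\lambda_s(y,x,1)=x$ and $\lambda_s(x,x,t)=x$ for all $x,y\in Z_s$ and $t\in[0,1]$. Let $Z=\prod_{s\in S}Z_s$ be equipped with the box topology, i.e. the topology generated by all sets $\prod_{s\in S}G_s$ with every $G_s$ open in $Z_s$. Let $g:X\to Z$ be a Baire-one map, i.e. there are continuous maps $g_n:X\to Z$, $n\in\mathbb N$, with $g_n(x)\to g(x)$ in $Z$ for every $x\in X$. Then there exists a map $f:X\times X\to Z$ that is separately continuous (for every $x\in X$ the maps $y\mapsto f(x,y)$ and $y\mapsto f(y,x)$ are continuous) and has diagonal $g$, i.e. $f(x,x)=g(x)$ for all $x\in X$. -/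

import Mathlib

open Filter Topology

/-- The product of a family of spaces, as a type synonym of the dependent function type, so that it
carries the box topology below and not Mathlib's (Tychonoff) product topology. -/
def BoxProd {S : Type*} (Z : S → Type*) : Type _ := ∀ s, Z s

/-- The box topology: generated by all boxes `∏ G s` with every `G s` open. -/
instance BoxProd.instTopologicalSpace {S : Type*} (Z : S → Type*)
    [∀ s, TopologicalSpace (Z s)] : TopologicalSpace (BoxProd Z) :=
  TopologicalSpace.generateFrom
    {B : Set (BoxProd Z) | ∃ G : ∀ s, Set (Z s), (∀ s, IsOpen (G s)) ∧ B = {z | ∀ s, z s ∈ G s}}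

/-- A space `Y` is equiconnected if there is a continuous `l : Y × Y × [0,1] → Y` with
`l (x, y, 0) = l (y, x, 1) = x` and `l (x, x, t) = x`. -/
def IsEquiconnected (Y : Type*) [TopologicalSpace Y] : Prop :=
  ∃ l : (Y × Y) × unitInterval → Y, Continuous l ∧
    (∀ x y, l ((x, y), 0) = x ∧ l ((y, x), 1) = x) ∧ ∀ x t, l ((x, x), t) = x

/-- A Baire-one map: a pointwise limit of a sequence of continuous maps. -/
def IsBaireOne {X Y : Type*} [TopologicalSpace X] [TopologicalSpace Y] (g : X → Y) : Prop :=
  ∃ u : ℕ → X → Y, (∀ n, Continuous (u n)) ∧ ∀ x, Tendsto (fun n => u n x) atTop (𝓝 (g x))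

/-- A map of two variables that is continuous in each variable, the other being fixed. -/
def IsSeparatelyContinuous {X Y Z : Type*} [TopologicalSpace X] [TopologicalSpace Y]
    [TopologicalSpace Z] (f : X × Y → Z) : Prop :=
  (∀ x, Continuous fun y => f (x, y)) ∧ ∀ y, Continuous fun x => f (x, y)

/-! The map `f` is built coordinate by coordinate, so that each section `f (x, ·)` and `f (·, y)`
varies in finitely many coordinates only; a map with this property is continuous for the box
topology as soon as its coordinates are continuous (`BoxProd.continuous_of_finite`).

Let `u n → g` pointwise. A convergent sequence in a box product eventually agrees with its limit
outside a finite set of coordinates (`BoxProd.exists_finite_of_tendsto`), and any two values of a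
continuous map on a connected space differ in finitely many coordinates only
(`BoxProd.finite_ne_of_continuous`). Fix a value `c` of `g`. After dropping finitely many of the
maps `u n`, for each `x` the set `F x` of the coordinates in which some `u n x` differs from `c` is
finite.

The map `seqDist u`, a supremum over all `n` and all coordinates of truncated distances between
`u n x` and `u n y`, is a pseudometric on `X`, and it is continuous since the box topology is finer
than the topology of uniform convergence. With the equiconnecting maps, `u n` is changed to `v n`
(`cutoff`) by pushing to `c s` the coordinates of `u n x` at distance at most about `1 / n` from
`c s`; still `v n → g`. Then `f (x, y)` is the point at time `1 / seqDist u x y` of the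
curve through `v 0 x, v 1 x, …`, and `g x` if `seqDist u x y = 0`. The curve of `x` tends to `g x`,
and its coordinates outside `F x` are constant; this gives the continuity in `y`. For fixed `y`, only
those `v n x` are used for which `u n x` is within about `1 / n` of `u n y`. So they
converge to `g y` as `seqDist u x y → 0`, and by the choice of the cutoff they have the coordinates
of `c` outside `F y`; this gives the continuity in `x`. -/

/-! ### Box products -/

theorem BoxProd.isOpen_box {S : Type*} {Z : S → Type*} [∀ s, TopologicalSpace (Z s)]
    {G : ∀ s, Set (Z s)} (hG : ∀ s, IsOpen (G s)) : IsOpen {z : BoxProd Z | ∀ s, z s ∈ G s} :=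
  TopologicalSpace.isOpen_generateFrom_of_mem ⟨G, hG, rfl⟩

theorem BoxProd.continuous_apply {S : Type*} {Z : S → Type*} [∀ s, TopologicalSpace (Z s)]
    (s : S) : Continuous fun z : BoxProd Z => z s := by
  classical
  refine continuous_def.2 fun U hU => ?_
  have h := BoxProd.isOpen_box (Z := Z)
    (G := fun t => {w | ∀ h : t = s, h ▸ w ∈ U}) (fun t => by
      by_cases h : t = s
      · subst h
        simpa using hU
      · simp [h])
  convert h using 1
  ext z
  constructor
  · rintro hz t rfl
    exact hz
  · intro hz
    exact hz s rfl

theorem BoxProd.continuous_of_finite {A S : Type*} [TopologicalSpace A] {Z : S → Type*}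
    [∀ s, TopologicalSpace (Z s)] {f : A → BoxProd Z} {c : BoxProd Z} {F : Set S} (hF : F.Finite)
    (hc : ∀ s ∉ F, ∀ a, f a s = c s) (hf : ∀ s, Continuous fun a => f a s) : Continuous f := by
  refine continuous_generateFrom_iff.2 ?_
  rintro _ ⟨G, hG, rfl⟩
  have h : f ⁻¹' {z | ∀ s, z s ∈ G s}
      = (⋂ s ∈ F, {a | f a s ∈ G s}) ∩ {_a | ∀ s ∉ F, c s ∈ G s} := by
    ext a
    simp only [Set.mem_preimage, Set.mem_ofPred_eq, Set.mem_inter_iff, Set.mem_iInter]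
    constructor
    · intro h
      exact ⟨fun s _ => h s, fun s hs => hc s hs a ▸ h s⟩
    · rintro ⟨h₁, h₂⟩ s
      by_cases hs : s ∈ F
      · exact h₁ s hs
      · rw [hc s hs a]
        exact h₂ s hs
  rw [h]
  exact (hF.isOpen_biInter fun s _ => (hG s).preimage (hf s)).inter isOpen_const

theorem BoxProd.exists_finite_of_tendsto {S : Type*} {Z : S → Type*} [∀ s, TopologicalSpace (Z s)]
    [∀ s, T1Space (Z s)] {z : ℕ → BoxProd Z} {w : BoxProd Z} (h : Tendsto z atTop (𝓝 w)) :
    ∃ N, {s | ∃ n ≥ N, z n s ≠ w s}.Finite := by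
  classical
  by_contra! hinf
  -- Infinitely many bad coordinates yield increasing indices `(e k).1` and distinct coordinates
  -- `(e k).2` such that `z` differs from `w` there.
  obtain ⟨e, he, hr⟩ := exists_seq_of_forall_finset_exists
    (fun p : ℕ × S => z p.1 p.2 ≠ w p.2) (fun p q => p.1 < q.1 ∧ p.2 ≠ q.2) (by
      intro T _
      obtain ⟨s, ⟨n, hn, hs⟩, hsT⟩ :=
        (hinf (T.sup Prod.fst + 1)).exists_notMem_finset (T.image Prod.snd)
      refine ⟨(n, s), hs, fun p hp => ⟨?_, ?_⟩⟩
      · have : p.1 ≤ T.sup Prod.fst := Finset.le_sup (f := Prod.fst) hp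
        exact lt_of_le_of_lt this hn
      · rintro h
        exact hsT (Finset.mem_image.2 ⟨p, hp, h⟩))
  have hmono : StrictMono fun k => (e k).1 := fun m n hmn => (hr m n hmn).1
  have hinj : Function.Injective fun k => (e k).2 := by
    intro m n hmn
    rcases lt_trichotomy m n with h | h | h
    · exact ((hr m n h).2 hmn).elim
    · exact h
    · exact ((hr n m h).2 hmn.symm).elim
  have hopen := BoxProd.isOpen_box (Z := Z)
    (G := fun s => ((fun k => z (e k).1 s) '' {k | (e k).2 = s})ᶜ) (fun s => by
      refine (Set.Finite.isClosed (Set.Finite.image _ (Set.Subsingleton.finite ?_))).isOpen_compl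
      intro m hm n hn
      exact hinj (hm.trans hn.symm))
  have hw : w ∈ {y : BoxProd Z | ∀ s, y s ∈ ((fun k => z (e k).1 s) '' {k | (e k).2 = s})ᶜ} := by
    rintro s ⟨k, rfl, hk⟩
    exact he k hk
  obtain ⟨M, hM⟩ := eventually_atTop.1 (h.eventually (hopen.mem_nhds hw))
  exact hM (e M).1 hmono.le_apply (e M).2 ⟨M, rfl, rfl⟩

theorem BoxProd.setOf_dist_lt_mem_nhds {S : Type*} {Z : S → Type*} [∀ s, MetricSpace (Z s)]
    (z : BoxProd Z) {r : S → ℝ} (hr : ∀ s, 0 < r s) :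
    {w : BoxProd Z | ∀ s, dist (w s) (z s) < r s} ∈ 𝓝 z :=
  (BoxProd.isOpen_box (G := fun s => Metric.ball (z s) (r s)) fun _ => Metric.isOpen_ball).mem_nhds
    fun s => Metric.mem_ball_self (hr s)

/-- Two values of a continuous map on a connected space differ in finitely many coordinates: if
`u x` and `u y` differed in coordinates `s₀, s₁, …`, then the points whose distance to `u x` in the
coordinate `sₖ` is `O(1 / k)` times that of `u y` would form a clopen set separating them. -/
theorem BoxProd.finite_ne_of_continuous {X S : Type*} [TopologicalSpace X] [PreconnectedSpace X]
    {Z : S → Type*} [∀ s, MetricSpace (Z s)] {u : X → BoxProd Z} (hu : Continuous u) (x y : X) :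
    {s | u x s ≠ u y s}.Finite := by
  by_contra hinf
  let e := Set.Infinite.natEmbedding _ hinf
  have he : Function.Injective fun k => (e k : S) := Subtype.val_injective.comp e.injective
  let k : S → ℕ := Function.invFun fun k => (e k : S)
  have hk : ∀ n, k (e n) = n := Function.leftInverse_invFun he
  let D : S → ℝ := fun s => dist (u y s) (u x s)
  have hD : ∀ s, 0 ≤ D s := fun s => dist_nonneg
  let A : Set (BoxProd Z) :=
    {z | ∃ C : ℝ, ∀ s, D s ≠ 0 → k s * dist (z s) (u x s) ≤ C * D s}
  let r : S → ℝ := fun s => if D s = 0 then 1 else D s / (k s + 1)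
  have hr : ∀ s, 0 < r s := by
    intro s
    by_cases h : D s = 0
    · simp [r, h]
    · have : 0 < D s := lt_of_le_of_ne (hD s) (Ne.symm h)
      simp only [r, h, if_false]
      positivity
  have hA : ∀ z w : BoxProd Z, (∀ s, dist (w s) (z s) < r s) → z ∈ A → w ∈ A := by
    rintro z w h ⟨C, hC⟩
    refine ⟨C + 1, fun s hs => ?_⟩
    have h₁ : k s * dist (w s) (z s) ≤ D s := by
      have h₂ := h s
      simp only [r, hs, if_false] at h₂
      rw [lt_div_iff₀ (by positivity)] at h₂
      nlinarith [dist_nonneg (x := w s) (y := z s)]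
    have h₃ := mul_le_mul_of_nonneg_left (dist_triangle (w s) (z s) (u x s))
      (Nat.cast_nonneg (α := ℝ) (k s))
    linarith [hC s hs]
  have hclopen : IsClopen A := by
    constructor
    · rw [← isOpen_compl_iff, isOpen_iff_mem_nhds]
      intro z hz
      filter_upwards [BoxProd.setOf_dist_lt_mem_nhds z hr] with w hw hwA
      exact hz (hA w z (fun s => by rw [dist_comm]; exact hw s) hwA)
    · rw [isOpen_iff_mem_nhds]
      intro z hz
      filter_upwards [BoxProd.setOf_dist_lt_mem_nhds z hr] with w hw
      exact hA z w hw hz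
  have huniv := (hclopen.preimage hu).eq_univ ⟨x, 0, fun s _ => by simp⟩
  obtain ⟨C, hC⟩ : y ∈ u ⁻¹' A := huniv ▸ Set.mem_univ y
  obtain ⟨n, hn⟩ := exists_nat_gt C
  have hs : 0 < D (e n) := dist_pos.2 (Ne.symm (e n).2)
  have h := le_of_mul_le_mul_right (hC (e n) hs.ne') hs
  rw [hk] at h
  linarith

/-! ### A continuous pseudometric attached to a sequence of maps -/

section SeqDist

variable {X S : Type*} {Z : S → Type*} [∀ s, MetricSpace (Z s)]

/-- The pseudometric `sup min (dist (u n x s) (u n y s), 4 / (n + 1))` over all `n` and `s`. -/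
noncomputable def seqDist (u : ℕ → X → BoxProd Z) (x y : X) : ℝ :=
  ⨆ i : ℕ × S, min (dist (u i.1 x i.2) (u i.1 y i.2)) (4 / ((i.1 : ℝ) + 1))

variable (u : ℕ → X → BoxProd Z)

theorem seqDist_nonneg (x y : X) : 0 ≤ seqDist u x y :=
  Real.iSup_nonneg fun _ => le_min dist_nonneg (by positivity)

theorem seqDist_self (x : X) : seqDist u x x = 0 :=
  le_antisymm (Real.iSup_le (fun _ => by simp) le_rfl) (seqDist_nonneg u x x)

theorem seqDist_comm (x y : X) : seqDist u x y = seqDist u y x := by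
  simp only [seqDist, dist_comm]

theorem min_le_seqDist (x y : X) (n : ℕ) (s : S) :
    min (dist (u n x s) (u n y s)) (4 / ((n : ℝ) + 1)) ≤ seqDist u x y := by
  refine le_ciSup (f := fun i : ℕ × S =>
    min (dist (u i.1 x i.2) (u i.1 y i.2)) (4 / ((i.1 : ℝ) + 1))) ⟨4, ?_⟩ (n, s)
  rintro _ ⟨i, rfl⟩
  refine (min_le_right _ _).trans (div_le_self (by norm_num) ?_)
  linarith [Nat.cast_nonneg (α := ℝ) i.1]

theorem seqDist_triangle (x y z : X) : seqDist u x z ≤ seqDist u x y + seqDist u y z := by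
  refine Real.iSup_le (fun i => ?_) (add_nonneg (seqDist_nonneg u x y) (seqDist_nonneg u y z))
  have h₁ := min_le_seqDist u x y i.1 i.2
  have h₂ := min_le_seqDist u y z i.1 i.2
  have h₃ := dist_triangle (u i.1 x i.2) (u i.1 y i.2) (u i.1 z i.2)
  have h₄ : (0 : ℝ) ≤ 4 / ((i.1 : ℝ) + 1) := by positivity
  have h₅ := seqDist_nonneg u x y
  have h₆ := seqDist_nonneg u y z
  rcases min_le_iff.1 h₁ with h₁ | h₁
  · rcases min_le_iff.1 h₂ with h₂ | h₂
    · exact (min_le_left _ _).trans (by linarith)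
    · exact (min_le_right _ _).trans (by linarith)
  · exact (min_le_right _ _).trans (by linarith)

theorem dist_le_seqDist {x y : X} {n : ℕ} (h : seqDist u x y < 4 / ((n : ℝ) + 1)) (s : S) :
    dist (u n x s) (u n y s) ≤ seqDist u x y :=
  (min_le_iff.1 (min_le_seqDist u x y n s)).resolve_right h.not_ge

theorem eq_of_seqDist_eq_zero {x y : X} (h : seqDist u x y = 0) (n : ℕ) (s : S) :
    u n x s = u n y s := by
  refine dist_le_zero.1 (h ▸ dist_le_seqDist u ?_ s)
  rw [h]
  positivity

/-- For `2 ≤ n` the truncation at `4 / (n + 1)` has no effect, as `1 / (n - 1) < 4 / (n + 1)`; for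
`n ≤ 1` the factor `n - 1` is not positive. -/
theorem sub_one_mul_dist_le_one {x y : X} {n : ℕ} (h : ((n : ℝ) - 1) * seqDist u x y ≤ 1) (s : S) :
    ((n : ℝ) - 1) * dist (u n x s) (u n y s) ≤ 1 := by
  rcases le_or_gt n 1 with hn | hn
  · have h₁ : (n : ℝ) ≤ 1 := by exact_mod_cast hn
    nlinarith [dist_nonneg (x := u n x s) (y := u n y s)]
  · have h₁ : (2 : ℝ) ≤ n := by exact_mod_cast hn
    refine (mul_le_mul_of_nonneg_left (dist_le_seqDist u ?_ s) (by linarith)).trans h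
    rw [lt_div_iff₀ (by positivity)]
    nlinarith [seqDist_nonneg u x y]

theorem continuous_seqDist_left [TopologicalSpace X] (hu : ∀ n, Continuous (u n)) (y : X) :
    Continuous fun x => seqDist u x y := by
  refine continuous_iff_continuousAt.2 fun x => Metric.tendsto_nhds.2 fun ε hε => ?_
  obtain ⟨N, hN⟩ := exists_nat_gt (8 / ε)
  have h : ∀ᶠ x' in 𝓝 x, ∀ n < N, ∀ s, dist (u n x' s) (u n x s) < ε / 2 := by
    refine (Set.finite_lt_nat N).eventually_all.2 fun n _ => ?_
    exact (hu n).continuousAt.eventually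
      (BoxProd.setOf_dist_lt_mem_nhds (u n x) fun _ => half_pos hε)
  filter_upwards [h] with x' hx'
  have h₁ : seqDist u x' x ≤ ε / 2 := by
    refine Real.iSup_le (fun i => ?_) (half_pos hε).le
    rcases lt_or_ge i.1 N with hi | hi
    · exact (min_le_left _ _).trans (hx' i.1 hi i.2).le
    · refine (min_le_right _ _).trans ?_
      have hi' : (N : ℝ) ≤ i.1 := by exact_mod_cast hi
      rw [div_lt_iff₀ hε] at hN
      rw [div_le_iff₀ (by positivity)]
      nlinarith
  have h₂ := seqDist_triangle u x' x y
  have h₃ := seqDist_triangle u x x' y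
  rw [seqDist_comm u x x'] at h₃
  rw [Real.dist_eq, abs_lt]
  constructor <;> linarith

theorem continuous_seqDist_right [TopologicalSpace X] (hu : ∀ n, Continuous (u n)) (x : X) :
    Continuous fun y => seqDist u x y := by
  simp only [seqDist_comm u x]
  exact continuous_seqDist_left u hu x

end SeqDist

/-! ### Curves in an equiconnected space -/

section Equiconnected

variable {Y : Type*}

/-- By compactness of the unit interval, `l` maps pairs of points near `z` to points near `z`,
uniformly in the time. -/
theorem exists_nhds_forall_mem [TopologicalSpace Y] {l : (Y × Y) × unitInterval → Y}
    (hl : Continuous l) {z : Y} (hz : ∀ t, l ((z, z), t) = z) {V : Set Y} (hV : V ∈ 𝓝 z) :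
    ∃ U ∈ 𝓝 z, ∀ x ∈ U, ∀ y ∈ U, ∀ t, l ((x, y), t) ∈ V := by
  have h : ∀ᶠ q : Y × Y in 𝓝 (z, z), ∀ t ∈ (Set.univ : Set unitInterval), l (q, t) ∈ V :=
    isCompact_univ.eventually_forall_of_forall_eventually fun t _ =>
      hl.continuousAt.eventually (by rw [hz]; exact hV)
  rw [nhds_prod_eq] at h
  obtain ⟨U, hU, hUV⟩ := mem_prod_self_iff.1 h
  exact ⟨U, hU, fun x hx y hy t => hUV (Set.mk_mem_prod hx hy) t trivial⟩

/-- The curve that is at `v n` at time `n` and follows `l` in between. -/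
noncomputable def polyline (l : (Y × Y) × unitInterval → Y) (q : (ℕ → Y) × ℝ) : Y :=
  l ((q.1 ⌊q.2⌋₊, q.1 (⌊q.2⌋₊ + 1)), Set.projIcc 0 1 zero_le_one (q.2 - ⌊q.2⌋₊))

theorem continuousAt_polyline [TopologicalSpace Y] {l : (Y × Y) × unitInterval → Y}
    (hl : Continuous l) (hl₀ : ∀ x y, l ((x, y), 0) = x) (hl₁ : ∀ x y, l ((x, y), 1) = y)
    {q : (ℕ → Y) × ℝ} (hq : 0 < q.2) : ContinuousAt (polyline l) q := by
  -- With `m < q.2 < m + 2`, the curve is near `q` glued from two pieces, at the time `m + 1`.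
  obtain ⟨m, hm, hm'⟩ : ∃ m : ℕ, (m : ℝ) < q.2 ∧ q.2 < m + 2 := by
    have hpos : 0 < ⌈q.2⌉₊ := Nat.ceil_pos.2 hq
    have h₁ := Nat.ceil_lt_add_one hq.le
    have h₂ := Nat.lt_ceil.1 (Nat.sub_lt hpos one_pos)
    refine ⟨⌈q.2⌉₊ - 1, h₂, ?_⟩
    have h₃ := Nat.le_ceil q.2
    have h₄ : ((⌈q.2⌉₊ - 1 : ℕ) : ℝ) = ⌈q.2⌉₊ - 1 := by
      rw [Nat.cast_sub hpos, Nat.cast_one]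
    linarith
  let e : ℕ → (ℕ → Y) × ℝ → Y := fun n q =>
    l ((q.1 n, q.1 (n + 1)), Set.projIcc 0 1 zero_le_one (q.2 - n))
  have he : ∀ n, Continuous (e n) := fun n => by
    refine hl.comp (((by fun_prop : Continuous fun q : (ℕ → Y) × ℝ => (q.1 n, q.1 (n + 1)))).prodMk
      (continuous_projIcc.comp (by fun_prop)))
  have hglue : ∀ q : (ℕ → Y) × ℝ, q.2 = m + 1 → e m q = e (m + 1) q := by
    intro q hq
    have h₁ : Set.projIcc (0 : ℝ) 1 zero_le_one (q.2 - m) = 1 :=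
      Set.projIcc_of_right_le _ (by linarith)
    have h₀ : Set.projIcc (0 : ℝ) 1 zero_le_one (q.2 - (m + 1 : ℕ)) = 0 :=
      Set.projIcc_of_le_left _ (by push_cast; linarith)
    simp only [e, h₁, h₀, hl₀, hl₁]
  have hc : Continuous fun q : (ℕ → Y) × ℝ => if q.2 ≤ m + 1 then e m q else e (m + 1) q :=
    (he m).if_le (he (m + 1)) continuous_snd continuous_const hglue
  refine hc.continuousAt.congr ?_
  filter_upwards [continuous_snd.continuousAt.eventually (Ioo_mem_nhds hm hm')] with p hp
  have hp₀ : 0 ≤ p.2 := (Nat.cast_nonneg m).trans hp.1.le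
  have hfloor : ∀ n : ℕ, (n : ℝ) ≤ p.2 → p.2 < n + 1 → polyline l p = e n p := by
    intro n h₁ h₂
    rw [polyline, (Nat.floor_eq_iff hp₀).2 ⟨h₁, h₂⟩]
  split_ifs with h
  · rcases h.lt_or_eq with h | h
    · exact (hfloor m hp.1.le h).symm
    · rw [hglue p h, hfloor (m + 1) (by push_cast; exact h.ge) (by push_cast; linarith)]
  · refine (hfloor (m + 1) ?_ ?_).symm
    · push_cast
      exact (not_le.1 h).le
    · push_cast
      linarith [hp.2]

open Classical in
/-- The point of the curve through `v 0, v 1, …` at time `1 / r`, and `z` at time `∞`. -/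
noncomputable def curveAt (l : (Y × Y) × unitInterval → Y) (v : ℕ → Y) (r : ℝ) (z : Y) : Y :=
  if r = 0 then z else polyline l (v, r⁻¹)

/-- Only those `v n` enter in `curveAt l v r z` for which `(n - 1) * r ≤ 1`. -/
theorem curveAt_mem {l : (Y × Y) × unitInterval → Y} {v : ℕ → Y} {r : ℝ} (hr : 0 ≤ r) {z : Y}
    {U V : Set Y} (hUV : ∀ x ∈ U, ∀ y ∈ U, ∀ t, l ((x, y), t) ∈ V) (hz : z ∈ V) {N : ℕ}
    (hN : N * r < 1) (hv : ∀ n ≥ N, ((n : ℝ) - 1) * r ≤ 1 → v n ∈ U) :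
    curveAt l v r z ∈ V := by
  rw [curveAt]
  split_ifs with h
  · exact hz
  · have hr' : 0 < r := lt_of_le_of_ne hr (Ne.symm h)
    have h₁ : N ≤ ⌊r⁻¹⌋₊ := by
      refine Nat.le_floor ?_
      rw [← one_div, le_div_iff₀ hr']
      exact hN.le
    have h₂ : (⌊r⁻¹⌋₊ : ℝ) * r ≤ 1 := by
      have := Nat.floor_le (inv_nonneg.2 hr)
      rwa [← one_div, le_div_iff₀ hr', one_div] at this
    refine hUV _ (hv _ h₁ (by nlinarith)) _ (hv _ (h₁.trans (Nat.le_succ _)) ?_) _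
    push_cast
    linarith

theorem continuous_curveAt {A : Type*} [TopologicalSpace A] [TopologicalSpace Y]
    {l : (Y × Y) × unitInterval → Y} (hl : Continuous l) (hl₀ : ∀ x y, l ((x, y), 0) = x)
    (hl₁ : ∀ x y, l ((x, y), 1) = y) (hl₂ : ∀ x t, l ((x, x), t) = x)
    {v : A → ℕ → Y} (hv : ∀ n, Continuous fun a => v a n) {r : A → ℝ} (hr : Continuous r)
    (hr₀ : ∀ a, 0 ≤ r a) {z : Y}
    (h : ∀ V ∈ 𝓝 z, ∃ N : ℕ, ∀ n ≥ N, ∀ a, ((n : ℝ) - 1) * r a ≤ 1 → v a n ∈ V) :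
    Continuous fun a => curveAt l (v a) (r a) z := by
  refine continuous_iff_continuousAt.2 fun a => ?_
  by_cases ha : r a = 0
  · intro V hV
    have hV' : V ∈ 𝓝 z := by simpa [curveAt, ha] using hV
    obtain ⟨U, hU, hUV⟩ := exists_nhds_forall_mem hl (hl₂ z) hV'
    obtain ⟨N, hN⟩ := h U hU
    have hlt : ∀ᶠ b in 𝓝 a, N * r b < 1 :=
      (continuous_const.mul hr).continuousAt.eventually_lt continuousAt_const (by simp [ha])
    rw [Filter.mem_map]
    filter_upwards [hlt] with b hb
    exact curveAt_mem (hr₀ b) hUV (mem_of_mem_nhds hV') hb fun n hn => hN n hn b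
  · have hpos : 0 < (v a, (r a)⁻¹).2 := inv_pos.2 (lt_of_le_of_ne (hr₀ a) (Ne.symm ha))
    have hc : ContinuousAt (fun b => polyline l (v b, (r b)⁻¹)) a :=
      ContinuousAt.comp (f := fun b => (v b, (r b)⁻¹)) (continuousAt_polyline hl hl₀ hl₁ hpos)
        ((continuous_pi hv).continuousAt.prodMk (hr.continuousAt.inv₀ ha))
    refine hc.congr ?_
    filter_upwards [hr.continuousAt.eventually_ne ha] with b hb
    simp [curveAt, hb]

/-! ### Cutting off near a base point -/

/-- The `n`-th cutoff moves to the base point `c` the points `w` with `(n - 1) * dist w c ≤ 1`, and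
keeps those with `(n - 1) * dist w c ≥ 2`. -/
noncomputable def cutoff [MetricSpace Y] (l : (Y × Y) × unitInterval → Y) (c : Y) (n : ℕ)
    (w : Y) : Y :=
  l ((c, w), Set.projIcc 0 1 zero_le_one (((n : ℝ) - 1) * dist w c - 1))

theorem continuous_cutoff [MetricSpace Y] {l : (Y × Y) × unitInterval → Y} (hl : Continuous l)
    (c : Y) (n : ℕ) : Continuous (cutoff l c n) :=
  hl.comp ((by fun_prop : Continuous fun w : Y => (c, w)).prodMk
    (continuous_projIcc.comp (by fun_prop)))

theorem cutoff_eq_base [MetricSpace Y] {l : (Y × Y) × unitInterval → Y}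
    (hl₀ : ∀ x y, l ((x, y), 0) = x) {c : Y} {n : ℕ} {w : Y}
    (h : ((n : ℝ) - 1) * dist w c ≤ 1) : cutoff l c n w = c := by
  rw [cutoff, Set.projIcc_of_le_left _ (by linarith)]
  exact hl₀ c w

theorem cutoff_eq_self [MetricSpace Y] {l : (Y × Y) × unitInterval → Y}
    (hl₁ : ∀ x y, l ((x, y), 1) = y) {c : Y} {n : ℕ} {w : Y}
    (h : 2 ≤ ((n : ℝ) - 1) * dist w c) : cutoff l c n w = w := by
  rw [cutoff, Set.projIcc_of_right_le _ (by linarith)]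
  exact hl₁ c w

/-- If `y n → z`, then the `n`-th cutoffs of points within `1 / (n - 1)` of `y n` tend to `z`,
uniformly in these points. -/
theorem exists_forall_cutoff_mem [MetricSpace Y] {l : (Y × Y) × unitInterval → Y}
    (hl : Continuous l) (hl₁ : ∀ x y, l ((x, y), 1) = y) (hl₂ : ∀ x t, l ((x, x), t) = x)
    (c : Y) {y : ℕ → Y} {z : Y} (hy : Tendsto y atTop (𝓝 z)) {V : Set Y} (hV : V ∈ 𝓝 z) :
    ∃ N : ℕ, ∀ n ≥ N, ∀ w, ((n : ℝ) - 1) * dist w (y n) ≤ 1 → cutoff l c n w ∈ V := by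
  have key : ∀ ε > 0, ∃ N : ℕ, ∀ n ≥ N, ∀ w, ((n : ℝ) - 1) * dist w (y n) ≤ 1 →
      dist w z < ε := by
    intro ε hε
    obtain ⟨N₁, hN₁⟩ := eventually_atTop.1 (Metric.tendsto_nhds.1 hy (ε / 2) (half_pos hε))
    obtain ⟨N₂, hN₂⟩ := exists_nat_gt (2 / ε)
    refine ⟨max N₁ (N₂ + 1), fun n hn w hw => ?_⟩
    have h₁ := hN₁ n (le_of_max_le_left hn)
    have h₂ : ((N₂ : ℝ) + 1) ≤ n := by exact_mod_cast le_of_max_le_right hn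
    rw [div_lt_iff₀ hε] at hN₂
    have h₃ : dist w (y n) < ε / 2 := by
      by_contra! h
      nlinarith [Nat.cast_nonneg (α := ℝ) N₂]
    linarith [dist_triangle w (y n) z]
  obtain rfl | hzc := eq_or_ne z c
  · obtain ⟨U, hU, hUV⟩ := exists_nhds_forall_mem hl (hl₂ z) hV
    obtain ⟨ε, hε, hεU⟩ := Metric.mem_nhds_iff.1 hU
    obtain ⟨N, hN⟩ := key ε hε
    exact ⟨N, fun n hn w hw => hUV _ (mem_of_mem_nhds hU) _ (hεU (hN n hn w hw)) _⟩
  · obtain ⟨ε, hε, hεV⟩ := Metric.mem_nhds_iff.1 hV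
    have hpos : 0 < dist z c := dist_pos.2 hzc
    obtain ⟨N₁, hN₁⟩ := key (min ε (dist z c / 2)) (lt_min hε (half_pos hpos))
    obtain ⟨N₂, hN₂⟩ := exists_nat_gt (4 / dist z c)
    refine ⟨max N₁ (N₂ + 1), fun n hn w hw => ?_⟩
    have h₁ := hN₁ n (le_of_max_le_left hn) w hw
    have h₂ : ((N₂ : ℝ) + 1) ≤ n := by exact_mod_cast le_of_max_le_right hn
    have h₃ : dist z c / 2 ≤ dist w c := by
      have := dist_triangle z w c
      rw [dist_comm z w] at this
      linarith [h₁.trans_le (min_le_right _ _)]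
    rw [cutoff_eq_self hl₁]
    · exact hεV (h₁.trans_le (min_le_left _ _))
    · rw [div_lt_iff₀ hpos] at hN₂
      nlinarith [Nat.cast_nonneg (α := ℝ) N₂]

end Equiconnected

/-! ### Separately continuous maps with a given diagonal -/

/-- The case in which the maps `u n` together move each point off `c` in finitely many coordinates;
`X` is arbitrary here. -/
theorem exists_isSeparatelyContinuous_of_finite {X S : Type*} [TopologicalSpace X] {Z : S → Type*}
    [∀ s, MetricSpace (Z s)] (hZ : ∀ s, IsEquiconnected (Z s)) {g : X → BoxProd Z}
    {u : ℕ → X → BoxProd Z} (hu : ∀ n, Continuous (u n))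
    (hg : ∀ x s, Tendsto (fun n => u n x s) atTop (𝓝 (g x s))) (c : BoxProd Z)
    (hc : ∀ x, {s | ∃ n, u n x s ≠ c s}.Finite) :
    ∃ f : X × X → BoxProd Z, IsSeparatelyContinuous f ∧ ∀ x, f (x, x) = g x := by
  choose l hl hl' hl₂ using hZ
  have hl₀ : ∀ s x y, l s ((x, y), 0) = x := fun s x y => (hl' s x y).1
  have hl₁ : ∀ s x y, l s ((x, y), 1) = y := fun s x y => (hl' s y x).2
  let v : X → ∀ s, ℕ → Z s := fun x s n => cutoff (l s) (c s) n (u n x s)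
  have hv : ∀ s n, Continuous fun x => v x s n := fun s n =>
    (continuous_cutoff (hl s) (c s) n).comp ((BoxProd.continuous_apply s).comp (hu n))
  have hgc : ∀ x s, (∀ n, u n x s = c s) → g x s = c s := fun x s h =>
    tendsto_nhds_unique (hg x s) (by simp only [h]; exact tendsto_const_nhds)
  have hgg : ∀ x y, seqDist u x y = 0 → ∀ s, g x s = g y s := fun x y h s =>
    tendsto_nhds_unique (hg x s) (by
      simp only [eq_of_seqDist_eq_zero u h]
      exact hg y s)
  -- For fixed `y` all curves end in the same point `g y`: the end point is used only if `g x = g y`.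
  have hswap : ∀ x y s, curveAt (l s) (v x s) (seqDist u x y) (g x s)
      = curveAt (l s) (v x s) (seqDist u x y) (g y s) := by
    intro x y s
    by_cases h : seqDist u x y = 0
    · rw [hgg x y h s]
    · simp only [curveAt, h, if_false]
  have hconst : ∀ x y s z, z = c s → (∀ n : ℕ, ((n : ℝ) - 1) * seqDist u x y ≤ 1 →
      v x s n = c s) → curveAt (l s) (v x s) (seqDist u x y) z = c s := by
    intro x y s z h₁ h₂
    refine curveAt_mem (N := 0) (U := {c s}) (V := {c s}) (seqDist_nonneg u x y) ?_ h₁ (by simp)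
      fun n _ => h₂ n
    rintro _ rfl _ rfl t
    exact hl₂ s _ t
  refine ⟨fun q s => curveAt (l s) (v q.1 s) (seqDist u q.1 q.2) (g q.1 s), ⟨?_, ?_⟩, ?_⟩
  · intro x
    refine BoxProd.continuous_of_finite (c := c) (hc x) ?_ ?_
    · intro s hs y
      have hs' : ∀ n, u n x s = c s := by simpa using hs
      refine hconst x y s _ (hgc x s hs') fun n _ => cutoff_eq_base (hl₀ s) ?_
      simp [hs']
    · intro s
      refine continuous_curveAt (hl s) (hl₀ s) (hl₁ s) (hl₂ s) (v := fun _ => v x s)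
        (z := g x s)
        (fun n => continuous_const)
        (continuous_seqDist_right u hu x) (seqDist_nonneg u x) fun V hV => ?_
      obtain ⟨N, hN⟩ := exists_forall_cutoff_mem (hl s) (hl₁ s) (hl₂ s) (c s) (hg x s) hV
      exact ⟨N, fun n hn _ _ => hN n hn _ (by simp)⟩
  · intro y
    refine BoxProd.continuous_of_finite (c := c) (hc y) ?_ ?_
    · intro s hs x
      have hs' : ∀ n, u n y s = c s := by simpa using hs
      refine (hswap x y s).trans (hconst x y s _ (hgc y s hs') fun n hn =>
        cutoff_eq_base (hl₀ s) ?_)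
      rw [← hs' n]
      exact sub_one_mul_dist_le_one u hn s
    · intro s
      simp only [hswap _ y s]
      refine continuous_curveAt (hl s) (hl₀ s) (hl₁ s) (hl₂ s) (hv s)
        (continuous_seqDist_left u hu y) (fun x => seqDist_nonneg u x y) fun V hV => ?_
      obtain ⟨N, hN⟩ := exists_forall_cutoff_mem (hl s) (hl₁ s) (hl₂ s) (c s) (hg y s) hV
      exact ⟨N, fun n hn x hx => hN n hn _ (sub_one_mul_dist_le_one u hx s)⟩
  · intro x
    funext s
    simp [curveAt, seqDist_self]

theorem mainTheorem1 {X : Type*} [TopologicalSpace X] [T2Space X] [ParacompactSpace X]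
    [PreconnectedSpace X] {S : Type*} (Z : S → Type*) [∀ s, TopologicalSpace (Z s)]
    [∀ s, TopologicalSpace.MetrizableSpace (Z s)] (hZ : ∀ s, IsEquiconnected (Z s))
    (g : X → BoxProd Z) (hg : IsBaireOne g) :
    ∃ f : X × X → BoxProd Z, IsSeparatelyContinuous f ∧ ∀ x, f (x, x) = g x := by
  let _ : ∀ s, MetricSpace (Z s) := fun s => TopologicalSpace.metrizableSpaceMetric (Z s)
  obtain ⟨u, hu, hug⟩ := hg
  rcases isEmpty_or_nonempty X with hX | ⟨⟨x₀⟩⟩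
  · exact ⟨fun q => g q.1, ⟨fun x => hX.elim x, fun x => hX.elim x⟩, fun x => hX.elim x⟩
  obtain ⟨N, hN⟩ := BoxProd.exists_finite_of_tendsto (hug x₀)
  refine exists_isSeparatelyContinuous_of_finite hZ (u := fun n => u (n + N))
    (fun n => hu (n + N)) (fun x s => ?_) (g x₀) fun x => ?_
  · exact ((BoxProd.continuous_apply s).tendsto (g x)).comp
      ((hug x).comp (tendsto_add_atTop_nat N))
  · have h₁ : ∀ n, {s | u (n + N) x s ≠ g x₀ s}.Finite := by
      intro n
      refine ((BoxProd.finite_ne_of_continuous (hu (n + N)) x x₀).union hN).subset fun s hs => ?_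
      by_cases h : u (n + N) x s = u (n + N) x₀ s
      · exact Or.inr ⟨n + N, Nat.le_add_left N n, h ▸ hs⟩
      · exact Or.inl h
    -- From the index `M` on, `u n x` agrees with `g x`, hence with `u (M + N) x`, outside a finite
    -- set; finitely many indices remain.
    obtain ⟨M, hM⟩ := BoxProd.exists_finite_of_tendsto (hug x)
    refine (hM.union ((Set.finite_le_nat M).biUnion fun n _ => h₁ n)).subset ?_
    rintro s ⟨n, hn⟩
    by_contra hs
    simp only [Set.mem_union, Set.mem_iUnion, Set.mem_ofPred_eq, not_or, not_exists, not_and,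
      not_not] at hs
    rcases le_total n M with h | h
    · exact hn (hs.2 n h)
    · exact hn ((hs.1 (n + N) (by omega)).trans
        ((hs.1 (M + N) (by omega)).symm.trans (hs.2 M le_rfl)))
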